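/- Let $(A,\mathfrak m_A,k)$ be an excellent regular local ring containing a field of characteristic $p>0$, and let $V\to\operatorname{Spec} A$ be a quasi-compact étale morphism of schemes. Then the derived tensor product $H^0(V,\mathcal O_V)\otimes^{\mathbf L}_A k$ is a discrete ring; that is, its homology $\operatorname{Tor}^A_n(H^0(V,\mathcal O_V),k)$ vanishes for every $n\ge 1$, and the natural map $$H^0(V,\mathcal O_V)\otimes^{\mathbf L}_A k\longrightarrow H^0(V,\mathcal O_V)\otimes_A k$$ is a quasi-isomorphism onto the ordinary tensor product ring placed in degree $0$. Here a ring is excellent if it is a Noetherian G-ring that is J-2 and universally catenary. -/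

import Mathlib

universe u v

noncomputable section

open CategoryTheory TensorProduct

/-! ### Excellent rings -/

/-- An algebra `S` over a field `k` is geometrically regular if `K ⊗[k] S` is a (Noetherian) regular
ring for every finite field extension `K` of `k`. -/
def IsGeometricallyRegular (k S : Type u) [Field k] [CommRing S] [Algebra k S] : Prop :=
  ∀ (K : Type u) [Field K] [Algebra k K], Module.Finite k K → IsRegularRing (K ⊗[k] S)

/-- The structure map `R → S` is a regular ring map: it is flat, and its fibre `κ(p) ⊗[R] S` over
every prime `p` of `R` is (Noetherian and) geometrically regular over `κ(p)`. -/
def IsRegularMap (R S : Type u) [CommRing R] [CommRing S] [Algebra R S] : Prop :=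
  Module.Flat R S ∧
    ∀ (p : Ideal R) [p.IsPrime], IsGeometricallyRegular p.ResidueField (p.ResidueField ⊗[R] S)

/-- A Noetherian ring is a G-ring if for every prime `p` the map from `R_p` to its completion at
the maximal ideal is regular. -/
def IsGrothendieckRing (R : Type u) [CommRing R] : Prop :=
  IsNoetherianRing R ∧ ∀ (p : Ideal R) [p.IsPrime],
    IsRegularMap (Localization.AtPrime p)
      (AdicCompletion (IsLocalRing.maximalIdeal (Localization.AtPrime p)) (Localization.AtPrime p))

/-- A ring is J-2 if it is Noetherian and the regular locus in the spectrum of every algebra of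
finite type over it is open. -/
def IsJ2Ring (R : Type u) [CommRing R] : Prop :=
  IsNoetherianRing R ∧ ∀ (S : Type u) [CommRing S] [Algebra R S], Algebra.FiniteType R S →
    IsOpen {q : PrimeSpectrum S | IsRegularLocalRing (Localization.AtPrime q.asIdeal)}

/-- A ring is catenary if for all primes `p ≤ q` the chains of primes from `p` to `q` have bounded
length, and the saturated ones (those that cannot be refined) all have the same length. -/
def IsCatenaryRing (R : Type u) [CommRing R] : Prop :=
  ∀ p q : PrimeSpectrum R, p ≤ q → ∃ n : ℕ,
    (∀ s : LTSeries (PrimeSpectrum R), s.head = p → s.last = q → s.length ≤ n) ∧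
    (∀ s : RelSeries {(a, b) : PrimeSpectrum R × PrimeSpectrum R | a ⋖ b},
      s.head = p → s.last = q → s.length = n)

/-- A ring is universally catenary if it is Noetherian and every algebra of finite type over it is
catenary. -/
def IsUniversallyCatenaryRing (R : Type u) [CommRing R] : Prop :=
  IsNoetherianRing R ∧ ∀ (S : Type u) [CommRing S] [Algebra R S], Algebra.FiniteType R S →
    IsCatenaryRing S

/-- Excellent rings: Noetherian G-rings that are J-2 and universally catenary. -/
structure IsExcellentRing (R : Type u) [CommRing R] : Prop where
  isNoetherianRing : IsNoetherianRing R
  isGrothendieckRing : IsGrothendieckRing R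
  isJ2Ring : IsJ2Ring R
  isUniversallyCatenaryRing : IsUniversallyCatenaryRing R

/-! ### Global sections -/

section GlobalSections

open AlgebraicGeometry

variable {A : Type u} [CommRing A] {V : Scheme.{u}}

/-- The ring `H⁰(V, 𝒪_V)` of global sections of a scheme `f : V ⟶ Spec A` over `A`. -/
def GlobalSections (_f : V ⟶ Spec (CommRingCat.of A)) : Type u := Γ(V, ⊤)

instance globalSectionsCommRing (f : V ⟶ Spec (CommRingCat.of A)) : CommRing (GlobalSections f) :=
  inferInstanceAs (CommRing Γ(V, ⊤))

/-- The `A`-algebra structure of `H⁰(V, 𝒪_V)`, through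
`A ≅ H⁰(Spec A, 𝒪) → H⁰(V, 𝒪_V)`. -/
instance globalSectionsAlgebra (f : V ⟶ Spec (CommRingCat.of A)) : Algebra A (GlobalSections f) :=
  ((Scheme.ΓSpecIso (CommRingCat.of A)).inv ≫ f.appTop).hom.toAlgebra

end GlobalSections

/-! ### The derived tensor product -/

section DerivedTensor

variable (A : Type u) [CommRing A] (B C : Type u) [CommRing B] [CommRing C] [Algebra A B]
  [Algebra A C]

/-- The complex of `A`-modules underlying the derived tensor product `B ⊗ᴸ_A C` of two
`A`-algebras: `P ⊗_A C` for a projective resolution `P → B` of the `A`-module `B`. -/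
def derivedTensor : ChainComplex (ModuleCat.{u} A) ℕ :=
  ((MonoidalCategory.tensorRight (ModuleCat.of A C)).mapHomologicalComplex
    (ComplexShape.down ℕ)).obj (projectiveResolution (ModuleCat.of A B)).complex

/-- The natural map `B ⊗ᴸ_A C ⟶ B ⊗_A C`, where the ordinary tensor product is placed in degree
zero; it is induced by the augmentation `P ⟶ B`. -/
def derivedTensorToTensor : derivedTensor A B C ⟶
    (ChainComplex.single₀ (ModuleCat.{u} A)).obj (ModuleCat.of A (B ⊗[A] C)) :=
  ((MonoidalCategory.tensorRight (ModuleCat.of A C)).mapHomologicalComplex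
      (ComplexShape.down ℕ)).map (projectiveResolution (ModuleCat.of A B)).π ≫
    (HomologicalComplex.singleMapHomologicalComplex
      (MonoidalCategory.tensorRight (ModuleCat.of A C)) (ComplexShape.down ℕ) 0).hom.app
      (ModuleCat.of A B)

/-- The derived tensor product `B ⊗ᴸ_A C` is a discrete ring: its homology vanishes outside degree
zero, and the natural map identifies it with the ring `B ⊗_A C` placed in degree zero. -/
structure IsDiscreteDerivedTensor : Prop where
  exactAt (n : ℕ) (hn : n ≠ 0) : (derivedTensor A B C).ExactAt n
  quasiIso : QuasiIso (derivedTensorToTensor A B C)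

end DerivedTensor

end

/-! Write `B` for the ring of global sections, `𝔪` for the maximal ideal, and `F_*A` for `A` viewed
as an `A`-module through the `p`-th power map. It suffices to find generators of `𝔪` forming a
weakly regular sequence on both `A` and `B`: the terms of a projective resolution of `B`, and then
all its syzygies, are weakly regular for it too, so the resolution stays exact in positive degrees
modulo `𝔪` (`isDiscreteDerivedTensor_of_isWeaklyRegular`).

Regularity on `B` comes from bijectivity of the relative Frobenius `F_*A ⊗ B → F_*B`. This holds for
étale algebras (`relativeFrobenius_bijective_of_etale`). Now `B` is an equalizer of finite products
of these, and tensoring with `F_*A` preserves equalizers, since `F_*A` is flat by Kunz's theorem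
(`FrobeniusTwist.flat_of_isRegularLocalRing`).

Let `x ∉ 𝔪²` and `x b = 0`. Then `x ⊗ b` maps to `x b ^ p = 0`, so it vanishes. By flatness `x` lies
in the ideal generated by the `p`-th powers of elements of `Ann b`; if `b ≠ 0` this ideal is inside
`𝔪²`, a contradiction (`isSMulRegular_of_isPushout_frobeniusTwist`). Bijectivity passes to `B / xB`
over the regular ring `A / x`, and induction on dimension gives the whole sequence. -/

noncomputable section

open CategoryTheory TensorProduct

/-! ### The Frobenius twist of a ring -/

/-- The natural number `p` vanishes in the ring `R`. -/
class CastEqZero (p : ℕ) (R : Type*) [CommRing R] : Prop where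
  cast_eq_zero : (p : R) = 0

theorem CastEqZero.of_ringHom {R S : Type*} [CommRing R] [CommRing S] (p : ℕ) (f : R →+* S)
    [CastEqZero p R] : CastEqZero p S :=
  ⟨by rw [← map_natCast f, CastEqZero.cast_eq_zero, map_zero]⟩

/-- The `p`-th power map of a ring in which the prime `p` vanishes; the zero ring is allowed. -/
def powRingHom (p : ℕ) [hp : Fact p.Prime] (R : Type*) [CommRing R] [CastEqZero p R] :
    R →+* R where
  toFun x := x ^ p
  map_one' := one_pow p
  map_mul' x y := mul_pow x y p
  map_zero' := zero_pow hp.out.ne_zero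
  map_add' x y := by
    obtain ⟨r, hr⟩ := exists_add_pow_prime_eq hp.out x y
    rw [hr, CastEqZero.cast_eq_zero]
    ring

/-- The ring `R`, regarded as an algebra over itself by the `p`-th power map. -/
def FrobeniusTwist (_p : ℕ) (R : Type u) : Type u := R

namespace FrobeniusTwist

variable (p : ℕ)

instance (R : Type*) [CommRing R] : CommRing (FrobeniusTwist p R) := inferInstanceAs (CommRing R)

instance (R : Type*) [CommRing R] [IsNoetherianRing R] : IsNoetherianRing (FrobeniusTwist p R) :=
  inferInstanceAs (IsNoetherianRing R)

instance (R : Type*) [CommRing R] [CastEqZero p R] : CastEqZero p (FrobeniusTwist p R) :=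
  inferInstanceAs (CastEqZero p R)

instance (R : Type*) [CommRing R] [IsLocalRing R] : IsLocalRing (FrobeniusTwist p R) :=
  inferInstanceAs (IsLocalRing R)

/-- The identity of `R`, regarded as an isomorphism from `R` to its Frobenius twist. -/
def of (R : Type*) [CommRing R] : R ≃+* FrobeniusTwist p R := RingEquiv.refl R

variable [Fact p.Prime] (R S : Type*) [CommRing R] [CommRing S] [Algebra R S]

instance [CastEqZero p S] : Algebra R (FrobeniusTwist p S) :=
  ((of p S).toRingHom.comp ((powRingHom p S).comp (algebraMap R S))).toAlgebra

instance : Algebra (FrobeniusTwist p R) (FrobeniusTwist p S) :=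
  inferInstanceAs (Algebra R S)

variable {R S}

theorem algebraMap_apply [CastEqZero p S] (r : R) :
    algebraMap R (FrobeniusTwist p S) r = of p S (algebraMap R S r) ^ p := rfl

theorem algebraMap_self_apply [CastEqZero p R] (r : R) :
    algebraMap R (FrobeniusTwist p R) r = of p R r ^ p := rfl

theorem algebraMap_of (r : R) :
    algebraMap (FrobeniusTwist p R) (FrobeniusTwist p S) (of p R r) =
      of p S (algebraMap R S r) := rfl

variable (R S)

instance [CastEqZero p R] [CastEqZero p S] :
    IsScalarTower R (FrobeniusTwist p R) (FrobeniusTwist p S) :=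
  .of_algebraMap_eq fun r ↦ by
    rw [algebraMap_self_apply, algebraMap_apply, map_pow, algebraMap_of]

instance (T : Type*) [CommRing T] [Algebra S T] [Algebra R T] [IsScalarTower R S T]
    [CastEqZero p T] : IsScalarTower R S (FrobeniusTwist p T) :=
  .of_algebraMap_eq fun r ↦ by
    rw [algebraMap_apply, algebraMap_apply, ← IsScalarTower.algebraMap_apply]

instance (T : Type*) [CommRing T] [Algebra S T] [Algebra R T] [IsScalarTower R S T] :
    IsScalarTower (FrobeniusTwist p R) (FrobeniusTwist p S) (FrobeniusTwist p T) :=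
  inferInstanceAs (IsScalarTower R S T)

instance (T : Type*) [CommRing T] [Algebra S T] [Algebra R T] [IsScalarTower R S T]
    [CastEqZero p S] [CastEqZero p T] :
    IsScalarTower R (FrobeniusTwist p S) (FrobeniusTwist p T) :=
  .of_algebraMap_eq fun r ↦ by
    rw [algebraMap_apply, algebraMap_apply, map_pow, algebraMap_of,
      ← IsScalarTower.algebraMap_apply]

instance [Algebra.Etale R S] : Algebra.Etale (FrobeniusTwist p R) (FrobeniusTwist p S) :=
  inferInstanceAs (Algebra.Etale R S)

end FrobeniusTwist

/-! ### Algebras whose relative Frobenius is an isomorphism -/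

section RelativeFrobenius

variable (p : ℕ) [hp : Fact p.Prime] (A B : Type*) [CommRing A] [CommRing B] [Algebra A B]
  [CastEqZero p A] [CastEqZero p B]

/-- The relative Frobenius of an `A`-algebra `B`: the map `a ⊗ b ↦ a b ^ p`. -/
def relativeFrobenius : FrobeniusTwist p A ⊗[A] B →ₐ[FrobeniusTwist p A] FrobeniusTwist p B :=
  Algebra.TensorProduct.lift (Algebra.ofId _ _)
    (IsScalarTower.toAlgHom A B (FrobeniusTwist p B)) fun _ _ ↦ Commute.all _ _

@[simp]
theorem relativeFrobenius_tmul (a : FrobeniusTwist p A) (b : B) :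
    relativeFrobenius p A B (a ⊗ₜ b) = algebraMap _ (FrobeniusTwist p B) a *
      FrobeniusTwist.of p B b ^ p := rfl

/-- The pushout form can be pasted and cancelled, hence passes to quotients; the bijective form is
the one that is verified and applied to elements. -/
theorem isPushout_frobeniusTwist_iff :
    Algebra.IsPushout A (FrobeniusTwist p A) B (FrobeniusTwist p B) ↔
      Function.Bijective (relativeFrobenius p A B) := by
  rw [Algebra.isPushout_iff, IsBaseChange, IsTensorProduct]
  refine iff_of_eq (congrArg _ (funext fun x ↦ ?_))
  induction x with
  | zero => simp
  | add x y hx hy => rw [map_add, map_add, hx, hy]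
  | tmul a b =>
    simp only [TensorProduct.lift.tmul, relativeFrobenius_tmul]
    rw [← Algebra.smul_def]
    rfl

/-- The Frobenius of `F_*A ⊗ B` factors through the relative Frobenius, because `a ^ p ⊗ b ^ p = 1 ⊗
a b ^ p`. Hence elements of the kernel have zero `p`-th power. -/
theorem pow_eq_one_tmul_relativeFrobenius (x : FrobeniusTwist p A ⊗[A] B) :
    x ^ p = 1 ⊗ₜ (FrobeniusTwist.of p B).symm (relativeFrobenius p A B x) := by
  have : CastEqZero p (FrobeniusTwist p A ⊗[A] B) :=
    .of_ringHom p (algebraMap A (FrobeniusTwist p A ⊗[A] B))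
  induction x with
  | zero => simp [hp.out.ne_zero]
  | add x y hx hy =>
    have := map_add (powRingHom p (FrobeniusTwist p A ⊗[A] B)) x y
    change (x + y) ^ p = x ^ p + y ^ p at this
    rw [this, hx, hy, map_add, map_add, tmul_add]
  | tmul a b =>
    have : (FrobeniusTwist.of p B).symm (relativeFrobenius p A B (a ⊗ₜ[A] b)) =
      (FrobeniusTwist.of p A).symm a • b ^ p :=
      (Algebra.smul_def (R := A) (A := B) ((FrobeniusTwist.of p A).symm a) (b ^ p)).symm
    rw [this, tmul_smul, smul_tmul', Algebra.TensorProduct.tmul_pow, Algebra.smul_def,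
      FrobeniusTwist.algebraMap_self_apply]
    simp

/-- The relative Frobenius of an étale algebra is bijective. -/
theorem relativeFrobenius_bijective_of_etale [Algebra.Etale A B] :
    Function.Bijective (relativeFrobenius p A B) := by
  let φ := relativeFrobenius p A B
  let R := FrobeniusTwist p A ⊗[A] B
  let S := FrobeniusTwist p B
  let _ : Algebra R S := φ.toRingHom.toAlgebra
  have : IsScalarTower (FrobeniusTwist p A) R S := .of_algebraMap_eq fun x ↦ (φ.commutes x).symm
  have : Algebra.Etale R S := .of_restrictScalars (FrobeniusTwist p A) R S
  have hpow (s : S) : s ^ p = algebraMap R S (1 ⊗ₜ (FrobeniusTwist.of p B).symm s) := by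
    change _ = relativeFrobenius p A B _
    simp
  have : CastEqZero p (S ⊗[R] S) := .of_ringHom p (algebraMap S (S ⊗[R] S))
  -- Since `s ^ p` comes from `R`, the generators `1 ⊗ s - s ⊗ 1` of the diagonal ideal have zero
  -- `p`-th power.
  have hJ : IsNilpotent (KaehlerDifferential.ideal R S) := by
    rw [Ideal.FG.isNilpotent_iff_le_nilradical (KaehlerDifferential.ideal_fg R S),
      ← KaehlerDifferential.span_range_eq_ideal, Ideal.span_le]
    rintro _ ⟨s, rfl⟩
    refine ⟨p, ?_⟩
    have := map_sub (powRingHom p (S ⊗[R] S)) (1 ⊗ₜ s) (s ⊗ₜ 1)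
    refine this.trans ?_
    change ((1 : S) ⊗ₜ[R] s) ^ p - (s ⊗ₜ[R] (1 : S)) ^ p = _
    rw [Algebra.TensorProduct.tmul_pow, Algebra.TensorProduct.tmul_pow, one_pow, hpow,
      Algebra.algebraMap_eq_smul_one, tmul_smul, smul_tmul', sub_self]
  -- The two maps `S → S ⊗[R] S` agree modulo a nilpotent ideal, so they coincide by unramifiedness.
  -- A finite epimorphism is then surjective.
  have : Algebra.IsEpi R S := by
    rw [Algebra.isEpi_iff_forall_one_tmul_eq]
    intro s
    refine DFunLike.congr_fun (Algebra.FormallyUnramified.ext (R := R) (A := S)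
      (KaehlerDifferential.ideal R S) hJ (g₁ := Algebra.TensorProduct.includeRight)
      (g₂ := Algebra.TensorProduct.includeLeft) fun x ↦ ?_) s
    exact Ideal.Quotient.eq.mpr (KaehlerDifferential.one_smul_sub_smul_one_mem_ideal R x)
  have : Algebra.IsIntegral R S := ⟨fun s ↦ .of_pow hp.out.pos (hpow s ▸ isIntegral_algebraMap)⟩
  have : Module.Finite R S := Algebra.IsIntegral.finite
  have hsurj : Function.Surjective (algebraMap R S) :=
    (Algebra.isEpi_iff_surjective_algebraMap_of_finite (R := R) (A := S)).mp ‹_›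
  refine ⟨?_, hsurj⟩
  -- The kernel of a surjective étale map is idempotent; being also finitely generated and nil, it
  -- is zero.
  have hid := (Algebra.FormallyEtale.iff_of_surjective hsurj).mp inferInstance
  have hfg : (RingHom.ker (algebraMap R S)).FG :=
    Algebra.FinitePresentation.ker_fG_of_surjective (R := R) (Algebra.ofId R S) hsurj
  have hnil : IsNilpotent (RingHom.ker (algebraMap R S)) := by
    rw [Ideal.FG.isNilpotent_iff_le_nilradical hfg]
    intro x hx
    refine ⟨p, ?_⟩
    rw [pow_eq_one_tmul_relativeFrobenius]
    have : relativeFrobenius p A B x = 0 := hx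
    rw [this, map_zero, tmul_zero]
    exact zero_mem _
  obtain ⟨n, hn⟩ := hnil
  have : RingHom.ker (algebraMap R S) = ⊥ := by
    rcases n with _ | n
    · rw [pow_zero] at hn
      rw [← mul_one (RingHom.ker (algebraMap R S)), hn]
      exact mul_zero _
    · rw [← hid.pow_succ_eq n]; exact hn
  exact (RingHom.injective_iff_ker_eq_bot _).mpr this

end RelativeFrobenius

/-! ### Regular local rings -/

namespace IsRegularLocalRing

open IsLocalRing

/-- The class of `x` is nonzero in the cotangent space, so it extends to a basis; Nakayama's lemma
lifts the basis to generators. -/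
theorem exists_span_insert_eq_maximalIdeal {A : Type*} [CommRing A] [IsLocalRing A]
    [IsNoetherianRing A] {x : A} (hx : x ∈ maximalIdeal A) (hx' : x ∉ maximalIdeal A ^ 2) :
    ∃ t : Set A, t.Finite ∧ t.ncard + 1 ≤ (maximalIdeal A).spanFinrank ∧
      Ideal.span (insert x t) = maximalIdeal A := by
  let k := ResidueField A
  let π := (maximalIdeal A).toCotangent
  let v : CotangentSpace A := π ⟨x, hx⟩
  have hv : v ≠ 0 := fun h ↦ hx' (((maximalIdeal A).toCotangent_eq_zero _).mp h)
  have hli : LinearIndepOn k id ({v} : Set (CotangentSpace A)) :=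
    LinearIndepOn.singleton hv
  let E := hli.extend (Set.subset_univ _)
  let b := Module.Basis.extend hli
  have hvE : v ∈ E := hli.subset_extend _ rfl
  have : Finite E := Module.Finite.finite_basis b
  have hcard : E.ncard = (maximalIdeal A).spanFinrank := by
    rw [spanFinrank_maximalIdeal_eq_finrank_cotangentSpace, Module.finrank_eq_nat_card_basis b]
    rfl
  let g := Function.surjInv (maximalIdeal A).toCotangent_surjective
  have hg (w) : π (g w) = w := Function.surjInv_eq _ w
  have hfin : (E \ {v}).Finite := (Set.toFinite E).sdiff
  refine ⟨(fun w ↦ (g w : A)) '' (E \ {v}), hfin.image _, ?_, ?_⟩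
  · calc _ ≤ (E \ {v}).ncard + 1 := by gcongr; exact Set.ncard_image_le hfin
      _ = E.ncard := Set.ncard_sdiff_singleton_add_one hvE
      _ ≤ _ := hcard.le
  · have h1 : Submodule.span A (insert ⟨x, hx⟩ (g '' (E \ {v}))) = ⊤ := by
      rw [← CotangentSpace.span_image_eq_top_iff]
      have : π '' (insert ⟨x, hx⟩ (g '' (E \ {v}))) = E := by
        rw [Set.image_insert_eq, Set.image_image]
        simp only [hg, Set.image_id']
        exact Set.insert_sdiff_self_of_mem hvE
      change Submodule.span k (π '' _) = ⊤
      rw [this]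
      have := b.span_eq
      rwa [Module.Basis.range_extend] at this
    have h2 := congr(Submodule.map (maximalIdeal A).subtype $h1)
    rw [Submodule.map_span, Submodule.map_top, Submodule.range_subtype, Set.image_insert_eq,
      Set.image_image] at h2
    exact h2

variable {A : Type*} [CommRing A]

theorem isLocalRing_quotient_span_singleton [IsLocalRing A] {x : A} (hx : x ∈ maximalIdeal A) :
    IsLocalRing (A ⧸ Ideal.span {x}) :=
  have : Nontrivial (A ⧸ Ideal.span {x}) :=
    Ideal.Quotient.nontrivial_iff.mpr (by rwa [Ne, Ideal.span_singleton_eq_top])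
  .of_surjective' _ Ideal.Quotient.mk_surjective

theorem map_mk_maximalIdeal [IsLocalRing A] (I : Ideal A) [IsLocalRing (A ⧸ I)] :
    (maximalIdeal A).map (Ideal.Quotient.mk I) = maximalIdeal (A ⧸ I) := by
  rw [← IsLocalRing.eq_maximalIdeal (Ideal.comap_isMaximal_of_surjective (Ideal.Quotient.mk I)
    Ideal.Quotient.mk_surjective (K := maximalIdeal (A ⧸ I))),
    Ideal.map_comap_of_surjective _ Ideal.Quotient.mk_surjective]

theorem spanFinrank_maximalIdeal_quotient_add_one_le [IsLocalRing A] [IsNoetherianRing A]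
    {x : A} (hx : x ∈ maximalIdeal A) (hx' : x ∉ maximalIdeal A ^ 2)
    [IsLocalRing (A ⧸ Ideal.span {x})] :
    (maximalIdeal (A ⧸ Ideal.span {x})).spanFinrank + 1 ≤ (maximalIdeal A).spanFinrank := by
  obtain ⟨t, ht, hcard, hspan⟩ := exists_span_insert_eq_maximalIdeal hx hx'
  refine le_trans ?_ hcard
  have h0 : Ideal.Quotient.mk (Ideal.span {x}) x = 0 :=
    Ideal.Quotient.eq_zero_iff_mem.mpr (Ideal.mem_span_singleton_self x)
  rw [← map_mk_maximalIdeal, ← hspan, Ideal.map_span, Set.image_insert_eq, h0,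
    Ideal.span_insert_zero]
  gcongr
  exact (Submodule.spanFinrank_span_le_ncard_of_finite (ht.image _)).trans
    (Set.ncard_image_le ht)

/-- The embedding dimension drops by at least one and the Krull dimension by at most one. -/
theorem quotient_span_singleton [IsRegularLocalRing A] {x : A} (hx : x ∈ maximalIdeal A)
    (hx' : x ∉ maximalIdeal A ^ 2) : IsRegularLocalRing (A ⧸ Ideal.span {x}) := by
  have := isLocalRing_quotient_span_singleton hx
  refine of_spanFinrank_maximalIdeal_le _ ?_
  have h1 := spanFinrank_maximalIdeal_quotient_add_one_le hx hx'
  have h2 : ringKrullDim A ≤ ringKrullDim (A ⧸ Ideal.span {x}) + 1 := by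
    have := ringKrullDim_le_ringKrullDim_quotient_add_encard {x}
      (Set.singleton_subset_iff.mpr (by rwa [SetLike.mem_coe, ringJacobson_eq_maximalIdeal]))
    simpa using this
  rw [← spanFinrank_maximalIdeal (R := A)] at h2
  have h3 : (((maximalIdeal (A ⧸ Ideal.span {x})).spanFinrank + 1 : ℕ) : WithBot ℕ∞) ≤
      ringKrullDim (A ⧸ Ideal.span {x}) + 1 := le_trans (by exact_mod_cast h1) h2
  have h4 : ringKrullDim (A ⧸ Ideal.span {x}) ≠ ⊥ := ringKrullDim_ne_bot
  generalize ringKrullDim (A ⧸ Ideal.span {x}) = d at h3 h4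
  lift d to ℕ∞ using h4
  norm_cast at h3 ⊢
  exact (ENat.add_le_add_iff_right ENat.one_ne_top).mp (by exact_mod_cast h3)

theorem maximalIdeal_sq_ne [IsLocalRing A] [IsNoetherianRing A] (h : ¬ IsField A) :
    ¬ maximalIdeal A ≤ maximalIdeal A ^ 2 := fun hle ↦ by
  refine h (isField_iff_maximalIdeal_eq.mpr ?_)
  refine Submodule.eq_bot_of_le_smul_of_le_jacobson_bot (maximalIdeal A) _
    (maximalIdeal A).fg_of_isNoetherianRing ?_ (maximalIdeal_le_jacobson _)
  rwa [smul_eq_mul, ← pow_two]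

/-- Induction on the dimension of a regular local ring. -/
theorem induction_quotient {P : ∀ (A : Type u) [CommRing A] [IsRegularLocalRing A], Prop}
    (field : ∀ (A : Type u) [CommRing A] [IsRegularLocalRing A], IsField A → P A)
    (step : ∀ (A : Type u) [CommRing A] [IsRegularLocalRing A], ¬ IsField A →
      (∀ x ∈ maximalIdeal A, x ∉ maximalIdeal A ^ 2 →
        ∀ [IsRegularLocalRing (A ⧸ Ideal.span {x})], P (A ⧸ Ideal.span {x})) → P A)
    (A : Type u) [CommRing A] [IsRegularLocalRing A] : P A := by
  generalize hn : (maximalIdeal A).spanFinrank = n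
  induction n using Nat.strong_induction_on generalizing A with
  | _ n ih =>
    by_cases hA : IsField A
    · exact field A hA
    · refine step A hA fun x hx hx' _ ↦ ih _ ?_ _ rfl
      have := spanFinrank_maximalIdeal_quotient_add_one_le hx hx'
      lia

theorem isDomain (A : Type u) [CommRing A] [IsRegularLocalRing A] : IsDomain A := by
  refine induction_quotient (P := fun A _ _ ↦ IsDomain A) (fun A _ _ hA ↦ hA.isDomain) ?_ A
  · intro A _ _ hA ih
    obtain ⟨x, hx, hx'⟩ : ∃ x ∈ maximalIdeal A,
        x ∉ ⋃ I ∈ insert (maximalIdeal A ^ 2) (minimalPrimes A), (I : Set A) := by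
      by_contra! hcon
      -- Prime avoidance tolerates two exceptional ideals; both slots are filled by `𝔪²`, the only
      -- ideal in the union not known to be prime.
      obtain ⟨I, hI, hle⟩ := (Ideal.subset_union_prime_finite (f := id)
        ((minimalPrimes.finite_of_isNoetherianRing A).insert (maximalIdeal A ^ 2))
        (maximalIdeal A ^ 2) (maximalIdeal A ^ 2) (by
          rintro I (rfl | hI) h
          · exact absurd rfl h
          · exact fun _ ↦ hI.1.1)).mp hcon
      rcases hI with rfl | hI
      · exact maximalIdeal_sq_ne hA hle
      · have hIp : I.IsPrime := hI.1.1
        have : maximalIdeal A = I := le_antisymm hle (le_maximalIdeal hIp.ne_top)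
        have h0 : (maximalIdeal A).height = 0 := by
          rw [this]; exact Ideal.height_eq_zero_iff.mpr hI
        have h1 := spanFinrank_maximalIdeal (R := A)
        rw [← maximalIdeal_height_eq_ringKrullDim, h0] at h1
        have h2 : (maximalIdeal A).spanFinrank = 0 := by exact_mod_cast h1
        rw [Submodule.spanFinrank_eq_zero_iff_eq_bot
          (maximalIdeal A).fg_of_isNoetherianRing] at h2
        exact hA (isField_iff_maximalIdeal_eq.mpr h2)
    simp only [Set.mem_insert_iff, Set.iUnion_iUnion_eq_or_left, Set.mem_union, SetLike.mem_coe,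
      Set.mem_iUnion, not_or, not_exists] at hx'
    have := quotient_span_singleton hx hx'.1
    have := ih x hx hx'.1
    have hprime : (Ideal.span {x}).IsPrime := (Ideal.Quotient.isDomain_iff_prime _).mp this
    obtain ⟨q, hq, hle⟩ := Ideal.exists_minimalPrimes_le (I := ⊥) (J := Ideal.span {x}) bot_le
    have hqp : q.IsPrime := hq.1.1
    have hxq : x ∉ q := hx'.2 q hq
    -- As `q ⊆ (x)` is prime and `x ∉ q`, every element of `q` is `x` times an element of `q`;
    -- Nakayama's lemma applies.
    have hq0 : q = ⊥ := by
      refine Submodule.eq_bot_of_le_smul_of_le_jacobson_bot (maximalIdeal A) _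
        q.fg_of_isNoetherianRing (fun y hy ↦ ?_) (maximalIdeal_le_jacobson _)
      obtain ⟨a, rfl⟩ := Ideal.mem_span_singleton.mp (hle hy)
      exact Submodule.smul_mem_smul hx ((hqp.mem_or_mem hy).resolve_left hxq)
    subst hq0
    exact IsDomain.of_bot_isPrime A

theorem exists_mem_maximalIdeal_notMem_sq [IsLocalRing A] [IsNoetherianRing A] (h : ¬ IsField A) :
    ∃ x ∈ maximalIdeal A, x ∉ maximalIdeal A ^ 2 :=
  Set.not_subset.mp (maximalIdeal_sq_ne h)

end IsRegularLocalRing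

/-! ### Flatness criteria -/

section Flatness

open IsLocalRing

variable {A : Type*} [CommRing A]

theorem TensorProduct.compatibleSMul_of_surjective {S : Type*} [CommRing S] [Algebra A S]
    (hS : Function.Surjective (algebraMap A S)) (M N : Type*) [AddCommGroup M] [AddCommGroup N]
    [Module A M] [Module S M] [IsScalarTower A S M] [Module A N] [Module S N]
    [IsScalarTower A S N] : TensorProduct.CompatibleSMul A S M N where
  smul_tmul s m n := by
    obtain ⟨a, rfl⟩ := hS s
    rw [algebraMap_smul, algebraMap_smul, smul_tmul]

theorem Module.Flat.lTensor_restrictScalars_injective {S : Type*} [CommRing S] [Algebra A S]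
    (hS : Function.Surjective (algebraMap A S)) (M : Type*) [AddCommGroup M]
    [Module A M] [Module S M] [IsScalarTower A S M] [Module.Flat S M] {N P : Type*}
    [AddCommGroup N] [Module A N] [Module S N] [IsScalarTower A S N]
    [AddCommGroup P] [Module A P] [Module S P] [IsScalarTower A S P]
    (f : N →ₗ[S] P) (hf : Function.Injective f) :
    Function.Injective ((f.restrictScalars A).lTensor M) := by
  have := TensorProduct.compatibleSMul_of_surjective hS M N
  have := TensorProduct.compatibleSMul_of_surjective hS M P
  let e₁ := TensorProduct.equivOfCompatibleSMul A S S M N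
  let e₂ := TensorProduct.equivOfCompatibleSMul A S S M P
  have h (u) : (f.restrictScalars A).lTensor M (e₁ u) = e₂ (f.lTensor M u) := by
    induction u with
    | zero => simp
    | add x y hx hy => simp only [map_add, hx, hy]
    | tmul m n => rfl
  have hinj := Module.Flat.lTensor_preserves_injective_linearMap (M := M) f hf
  intro u v huv
  obtain ⟨u, rfl⟩ := e₁.surjective u
  obtain ⟨v, rfl⟩ := e₁.surjective v
  rw [h, h] at huv
  rw [hinj (e₂.injective huv)]

/-- In terms of Tor: if `Tor₁(M, A/(I + aA)) = 0`, then multiplication by `a` maps `Tor₁(M, A/(I :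
a))` onto `Tor₁(M, A/I)`. The proof tensors the exact sequence `(I : a) → I × A → I + aA → 0`, whose
first map is `r ↦ (a r, -r)`. -/
theorem Submodule.exists_lTensor_submoduleComap_eq (M : Type*) [AddCommGroup M] [Module A M]
    (I : Submodule A A) (a : A)
    (hinj : Function.Injective ((LinearMap.range
      (I.subtype.coprod (LinearMap.toSpanSingleton A A a))).subtype.lTensor M))
    (u : M ⊗[A] I) (hu : I.subtype.lTensor M u = 0) :
    ∃ w : M ⊗[A] (I.comap (LinearMap.lsmul A A a)),
      (I.comap (LinearMap.lsmul A A a)).subtype.lTensor M w = 0 ∧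
        ((LinearMap.lsmul A A a).submoduleComap I).lTensor M w = u := by
  let g := I.subtype.coprod (LinearMap.toSpanSingleton A A a)
  let f : (I.comap (LinearMap.lsmul A A a)) →ₗ[A] I × A :=
    ((LinearMap.lsmul A A a).submoduleComap I).prod (-(I.comap (LinearMap.lsmul A A a)).subtype)
  have hfg : Function.Exact f g.rangeRestrict := by
    intro z
    rw [Subtype.ext_iff]
    constructor
    · intro hz
      have hz' : (z.1 : A) + z.2 * a = 0 := hz
      refine ⟨⟨-z.2, ?_⟩, ?_⟩
      · have : a * -z.2 = z.1 := by linear_combination -hz'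
        change a * -z.2 ∈ I
        exact this ▸ z.1.2
      · refine Prod.ext (Subtype.ext ?_) (neg_neg z.2)
        change a * -z.2 = z.1
        linear_combination -hz'
    · rintro ⟨r, rfl⟩
      change a * (r : A) + -(r : A) * a = 0
      ring
  have hex := lTensor_exact M hfg g.surjective_rangeRestrict
  have h0 : g.rangeRestrict.lTensor M ((LinearMap.inl A I A).lTensor M u) = 0 := by
    apply hinj
    rw [map_zero, ← LinearMap.lTensor_comp_apply, ← LinearMap.lTensor_comp_apply, ← hu]
    congr 2
    ext i
    change (i : A) + 0 * a = i
    ring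
  obtain ⟨w, hw⟩ := (hex _).mp h0
  refine ⟨w, ?_, ?_⟩
  · have := congr((LinearMap.snd A I A).lTensor M $hw)
    rw [← LinearMap.lTensor_comp_apply, ← LinearMap.lTensor_comp_apply, LinearMap.snd_comp_inl,
      LinearMap.lTensor_zero, LinearMap.zero_apply, LinearMap.snd_prod, LinearMap.lTensor_neg,
      LinearMap.neg_apply, neg_eq_zero] at this
    exact this
  · have := congr((LinearMap.fst A I A).lTensor M $hw)
    rwa [← LinearMap.lTensor_comp_apply, ← LinearMap.lTensor_comp_apply, LinearMap.fst_comp_inl,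
      LinearMap.lTensor_id, LinearMap.id_apply, LinearMap.fst_prod] at this

/-- The local criterion of flatness over a Noetherian local ring. -/
theorem Module.Flat.of_lTensor_maximalIdeal_injective [IsLocalRing A] [IsNoetherianRing A]
    (S : Type*) [CommRing S] [Algebra A S] [IsNoetherianRing S]
    (hS : ∀ a ∈ maximalIdeal A, algebraMap A S a ∈ (⊥ : Ideal S).jacobson)
    (hinj : Function.Injective ((maximalIdeal A).subtype.lTensor S)) : Module.Flat A S := by
  rw [Module.Flat.iff_lTensor_injective]
  intro I _
  induction I using IsNoetherian.induction with
  | _ I ih =>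
    by_cases hI : I = ⊤
    · subst hI
      refine Function.LeftInverse.injective
        (g := (Submodule.topEquiv (R := A) (M := A)).symm.toLinearMap.lTensor S) fun u ↦ ?_
      rw [← LinearMap.lTensor_comp_apply]
      exact LinearMap.lTensor_id_apply S _ u
    by_cases hIm : I = maximalIdeal A
    · exact hIm ▸ hinj
    obtain ⟨a, ham, haI⟩ := SetLike.exists_of_lt (lt_of_le_of_ne (le_maximalIdeal hI) hIm)
    have hJ : I < LinearMap.range (I.subtype.coprod (LinearMap.toSpanSingleton A A a)) := by
      refine lt_of_le_of_ne (fun i hi ↦ ⟨(⟨i, hi⟩, 0), by simp⟩) fun h ↦ haI ?_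
      rw [h]
      exact ⟨(0, 1), by simp⟩
    have key := Submodule.exists_lTensor_submoduleComap_eq S I a
      (ih _ hJ (IsNoetherian.noetherian _))
    have hK : I ≤ I.comap (LinearMap.lsmul A A a) := fun i hi ↦ I.smul_mem a hi
    -- If `(I : a) = I`, the kernel equals `a` times itself and vanishes by Nakayama's lemma over
    -- `S`. Otherwise `(I : a)` is strictly larger and the induction hypothesis applies to it.
    by_cases hKI : I.comap (LinearMap.lsmul A A a) ≤ I
    · let T := LinearMap.ker (I.subtype.baseChange S)
      suffices T = ⊥ from LinearMap.ker_eq_bot (f := I.subtype.baseChange S).mp this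
      refine Submodule.eq_bot_of_le_smul_of_le_jacobson_bot
        (Ideal.span {algebraMap A S a}) T (IsNoetherian.noetherian T) (fun u hu ↦ ?_) ?_
      · obtain ⟨w, hw, rfl⟩ := key u hu
        have h1 : (LinearMap.lsmul A A a).submoduleComap I = a • Submodule.inclusion hKI := rfl
        rw [h1, LinearMap.lTensor_smul, LinearMap.smul_apply, ← algebraMap_smul S a]
        refine Submodule.smul_mem_smul (Ideal.mem_span_singleton_self _) ?_
        change I.subtype.lTensor S _ = 0
        rw [← LinearMap.lTensor_comp_apply]
        exact hw
      · rw [Ideal.span_singleton_le_iff_mem]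
        exact hS a ham
    · rw [injective_iff_map_eq_zero]
      intro u hu
      obtain ⟨w, hw, rfl⟩ := key u hu
      rw [ih _ (lt_of_le_not_ge hK hKI) (IsNoetherian.noetherian _) (hw.trans (map_zero _).symm),
        map_zero]

/-- Injectivity of `M ⊗ I → M` may be checked modulo an `M`-regular element of `I`. -/
theorem Ideal.lTensor_subtype_injective_of_quotient (M : Type*) [AddCommGroup M] [Module A M]
    {x : A} (hx : IsSMulRegular M x) (I : Ideal A) (hxI : x ∈ I)
    (hinj : Function.Injective
      (((I.map (Ideal.Quotient.mk (Ideal.span {x}))).subtype.restrictScalars A).lTensor M)) :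
    Function.Injective (I.subtype.lTensor M) := by
  let Ibar := I.map (Ideal.Quotient.mk (Ideal.span {x}))
  let q : I →ₗ[A] Ibar :=
    ((Ideal.Quotient.mkₐ A (Ideal.span {x})).toLinearMap ∘ₗ I.subtype).codRestrict
      (Ibar.restrictScalars A) fun i ↦ Ideal.mem_map_of_mem _ i.2
  have hq : Function.Surjective q := by
    rintro ⟨y, hy⟩
    obtain ⟨i, hi, rfl⟩ := (Ideal.mem_map_iff_of_surjective _ Ideal.Quotient.mk_surjective).mp hy
    exact ⟨⟨i, hi⟩, rfl⟩
  have hex : Function.Exact (LinearMap.toSpanSingleton A I ⟨x, hxI⟩) q := by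
    intro i
    rw [Subtype.ext_iff]
    change Ideal.Quotient.mk (Ideal.span {x}) (i : A) = 0 ↔ _
    rw [Ideal.Quotient.eq_zero_iff_mem, Ideal.mem_span_singleton']
    refine exists_congr fun a ↦ ?_
    rw [Subtype.ext_iff]
    rfl
  rw [injective_iff_map_eq_zero]
  intro u hu
  have h0 : q.lTensor M u = 0 := by
    apply hinj
    rw [map_zero, ← LinearMap.lTensor_comp_apply]
    have : (Ibar.subtype.restrictScalars A) ∘ₗ q =
        (Ideal.Quotient.mkₐ A (Ideal.span {x})).toLinearMap ∘ₗ I.subtype := rfl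
    rw [this, LinearMap.lTensor_comp_apply, hu, map_zero]
  -- So `u = m ⊗ x` for some `m`, and its image in `M` is `x m = 0`.
  obtain ⟨w, rfl⟩ := (lTensor_exact M hex hq u).mp h0
  obtain ⟨m, rfl⟩ := (TensorProduct.rid A M).symm.surjective w
  have h1 := congr(TensorProduct.rid A M $hu)
  simp only [TensorProduct.rid_symm_apply, LinearMap.lTensor_tmul, map_zero,
    LinearMap.toSpanSingleton_apply, one_smul, Submodule.subtype_apply,
    TensorProduct.rid_tmul] at h1
  rw [hx.right_eq_zero_of_smul h1]
  simp

end Flatness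

/-! ### Flatness of the Frobenius of a regular local ring -/

namespace FrobeniusTwist

open IsLocalRing

variable (p : ℕ) [hp : Fact p.Prime]

theorem isSMulRegular {A : Type*} [CommRing A] [CastEqZero p A] {x : A}
    (hx : x ∈ nonZeroDivisors A) : IsSMulRegular (FrobeniusTwist p A) x := by
  rw [isSMulRegular_iff_right_eq_zero_of_smul]
  intro n hn
  rw [Algebra.smul_def, algebraMap_self_apply] at hn
  have : x ^ p * (of p A).symm n = 0 := hn
  exact (mul_left_mem_nonZeroDivisors_eq_zero_iff (pow_mem hx p)).mp this

/-- Let `y` be `x` seen in `N = F_*A`, so that `x` acts on `N` as `y ^ p`. Then `N ⊗ A/x = N / y ^ p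
N` is filtered by powers of `y` with graded pieces `N / yN = F_*(A/x)`, which is flat over `A/x`.
The filtration is climbed on elements: one in the kernel is successively divisible by `y, …, y ^ p`,
and `y ^ p = x` kills `N ⊗ I`. -/
theorem lTensor_subtype_injective_of_flat_quotient {A : Type*} [CommRing A] [CastEqZero p A]
    {x : A} (hx : x ∈ nonZeroDivisors A) [CastEqZero p (A ⧸ Ideal.span {x})]
    [Module.Flat (A ⧸ Ideal.span {x}) (FrobeniusTwist p (A ⧸ Ideal.span {x}))]
    (I : Ideal (A ⧸ Ideal.span {x})) :
    Function.Injective ((I.subtype.restrictScalars A).lTensor (FrobeniusTwist p A)) := by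
  let Q := A ⧸ Ideal.span {x}
  let N := FrobeniusTwist p A
  let N₁ := FrobeniusTwist p Q
  let y : N := of p A x
  have hy : y ∈ nonZeroDivisors N := hx
  have hxy (n : N) : x • n = y ^ p * n := by rw [Algebra.smul_def, algebraMap_self_apply]
  let π : N →ₗ[A] N₁ := (IsScalarTower.toAlgHom A N N₁).toLinearMap
  let μ : N →ₗ[A] N := LinearMap.mulLeft A y
  let ι : I →ₗ[A] Q := I.subtype.restrictScalars A
  have hπ : Function.Surjective π :=
    Ideal.Quotient.mk_surjective (I := (Ideal.span {x} : Ideal A))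
  have hμπ : Function.Exact μ π := fun n ↦ by
    have : π n = 0 ↔ n ∈ Ideal.span {y} :=
      Ideal.Quotient.eq_zero_iff_mem (I := (Ideal.span {x} : Ideal A))
    rw [this, Ideal.mem_span_singleton']
    exact exists_congr fun a ↦ by rw [mul_comm]; rfl
  have hμ (v : N ⊗[A] I) : μ.rTensor I v = y • v := by
    induction v with
    | zero => simp
    | add v w hv hw => rw [map_add, hv, hw, smul_add]
    | tmul n i => rfl
  have hιsmul (n : N) (v : N ⊗[A] I) : ι.lTensor N (n • v) = n • ι.lTensor N v :=
    (ι.baseChange N).map_smul n v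
  let q : A →ₗ[A] Q := (Ideal.Quotient.mkₐ A (Ideal.span {x})).toLinearMap
  have hQ : Function.Exact (LinearMap.lsmul A A x) q := fun a ↦ by
    have : q a = 0 ↔ a ∈ Ideal.span {x} := Ideal.Quotient.eq_zero_iff_mem
    rw [this, Ideal.mem_span_singleton']
    exact exists_congr fun a ↦ by rw [mul_comm]; rfl
  have hQs : Function.Surjective q := Ideal.Quotient.mk_surjective
  have step1 (z : N ⊗[A] Q) (j : ℕ) (hj : j < p) (hz : y ^ j • z = 0) : π.rTensor Q z = 0 := by
    obtain ⟨z, rfl⟩ := LinearMap.lTensor_surjective N hQs z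
    obtain ⟨n, rfl⟩ := (TensorProduct.rid A N).symm.surjective z
    have h1 : q.lTensor N ((y ^ j * n) ⊗ₜ 1) = 0 := hz
    obtain ⟨w, hw⟩ := (lTensor_exact N hQ hQs _).mp h1
    obtain ⟨m, rfl⟩ := (TensorProduct.rid A N).symm.surjective w
    have h2 := congr(TensorProduct.rid A N $hw)
    simp only [TensorProduct.rid_symm_apply, LinearMap.lTensor_tmul, LinearMap.lsmul_apply,
      TensorProduct.rid_tmul, one_smul, smul_eq_mul, mul_one, hxy] at h2
    obtain ⟨k, rfl⟩ := Nat.exists_eq_add_of_lt hj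
    have h3 : n = y * (y ^ k * m) := by
      rw [← mul_cancel_left_mem_nonZeroDivisors (pow_mem hy j), ← h2]
      ring
    have h4 : π n = 0 := (hμπ n).mpr ⟨_, h3.symm⟩
    rw [TensorProduct.rid_symm_apply, LinearMap.lTensor_tmul, LinearMap.rTensor_tmul, h4, zero_tmul]
  have hflat : Function.Injective (ι.lTensor N₁) :=
    Module.Flat.lTensor_restrictScalars_injective Ideal.Quotient.mk_surjective N₁ I.subtype
      I.injective_subtype
  have step2 (v : N ⊗[A] I) (j : ℕ) (hj : j < p) (hv : y ^ j • ι.lTensor N v = 0) :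
      ∃ w, v = y • w := by
    have h1 : π.rTensor I v = 0 := by
      apply hflat
      rw [map_zero, ← step1 _ j hj hv, ← LinearMap.comp_apply, ← LinearMap.comp_apply,
        LinearMap.lTensor_comp_rTensor, LinearMap.rTensor_comp_lTensor]
    obtain ⟨w, rfl⟩ := (rTensor_exact I hμπ hπ v).mp h1
    exact ⟨w, hμ w⟩
  have step3 (u : N ⊗[A] I) (hu : ι.lTensor N u = 0) (j : ℕ) (hj : j ≤ p) :
      ∃ v, u = y ^ j • v := by
    induction j with
    | zero => exact ⟨u, by simp⟩
    | succ j ih =>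
      obtain ⟨v, rfl⟩ := ih (by lia)
      rw [hιsmul] at hu
      obtain ⟨w, rfl⟩ := step2 v j hj hu
      exact ⟨w, by rw [smul_smul, pow_succ]⟩
  rw [injective_iff_map_eq_zero]
  intro u hu
  obtain ⟨v, rfl⟩ := step3 u hu p le_rfl
  rw [← algebraMap_self_apply, algebraMap_smul]
  clear hu
  induction v with
  | zero => simp
  | add v w hv hw => rw [smul_add, hv, hw, add_zero]
  | tmul n i =>
    have hx : x • i = 0 := Subtype.ext <| by
      change algebraMap A Q x * (i : Q) = 0
      rw [show algebraMap A Q x = 0 from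
        Ideal.Quotient.eq_zero_iff_mem.mpr (Ideal.mem_span_singleton_self x), zero_mul]
    rw [smul_tmul', smul_tmul, hx, tmul_zero]

/-- **Kunz's theorem**: the Frobenius of a regular local ring is flat. -/
theorem flat_of_isRegularLocalRing (A : Type u) [CommRing A] [IsRegularLocalRing A]
    [CastEqZero p A] : Module.Flat A (FrobeniusTwist p A) := by
  refine IsRegularLocalRing.induction_quotient
    (P := fun A _ _ ↦ ∀ [CastEqZero p A], Module.Flat A (FrobeniusTwist p A)) ?_ ?_ A
  · intro A _ _ hA _
    let _ := hA.toField
    exact inferInstanceAs (Module.Flat A (FrobeniusTwist p A))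
  · intro A _ _ hA ih _
    have := IsRegularLocalRing.isDomain A
    obtain ⟨x, hx, hx'⟩ := IsRegularLocalRing.exists_mem_maximalIdeal_notMem_sq hA
    have := IsRegularLocalRing.quotient_span_singleton hx hx'
    have : CastEqZero p (A ⧸ Ideal.span {x}) := .of_ringHom p (algebraMap A _)
    have hx0 : x ∈ nonZeroDivisors A := mem_nonZeroDivisors_of_ne_zero fun h ↦
      hx' (h ▸ zero_mem _)
    have := ih x hx hx'
    -- The local criterion leaves only the ideal `𝔪`; as `x ∈ 𝔪` is regular on `F_*A`, this reduces
    -- to `𝔪 / x`, where flatness over `A / x` is used.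
    refine Module.Flat.of_lTensor_maximalIdeal_injective _ (fun a ha ↦ ?_)
      (Ideal.lTensor_subtype_injective_of_quotient _ (isSMulRegular p hx0) _ hx
        (lTensor_subtype_injective_of_flat_quotient p hx0 _))
    refine maximalIdeal_le_jacobson _ ?_
    rw [algebraMap_self_apply]
    exact Ideal.pow_mem_of_mem _ ha p hp.out.pos

end FrobeniusTwist

/-! ### Regular sequences on algebras with bijective relative Frobenius -/

theorem Ideal.isPushout_quotient_map {A : Type*} (B : Type*) [CommRing A] [CommRing B]
    [Algebra A B] (I : Ideal A) :
    Algebra.IsPushout A (A ⧸ I) B (B ⧸ I.map (algebraMap A B)) := by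
  refine .symm ⟨.of_equiv
    (Algebra.TensorProduct.quotIdealMapEquivTensorQuot B I).symm.toLinearEquiv fun a ↦ ?_⟩
  obtain ⟨a, rfl⟩ := Ideal.Quotient.mk_surjective a
  have h : (Algebra.TensorProduct.quotIdealMapEquivTensorQuot B I).symm
      (1 ⊗ₜ Ideal.Quotient.mk I a) = algebraMap (A ⧸ I) _ (Ideal.Quotient.mk I a) := by
    refine (Algebra.TensorProduct.quotIdealMapEquivTensorQuot_symm_tmul B I 1 a).trans ?_
    rw [← Algebra.algebraMap_eq_smul_one]
    rfl
  exact h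

section

open IsLocalRing RingTheory.Sequence
open scoped Pointwise

variable (p : ℕ) [hp : Fact p.Prime]

/-- Frobenius commutes with `A → A / I`, so the composite square can be factored in two ways;
pasting along one and cancelling along the other gives the claim. -/
theorem isPushout_frobeniusTwist_quotient (A B : Type*) [CommRing A] [CommRing B] [Algebra A B]
    [CastEqZero p A] [CastEqZero p B]
    [Algebra.IsPushout A (FrobeniusTwist p A) B (FrobeniusTwist p B)] (I : Ideal A)
    [CastEqZero p (A ⧸ I)] [CastEqZero p (B ⧸ I.map (algebraMap A B))] :
    Algebra.IsPushout (A ⧸ I) (FrobeniusTwist p (A ⧸ I)) (B ⧸ I.map (algebraMap A B))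
      (FrobeniusTwist p (B ⧸ I.map (algebraMap A B))) := by
  have h := Ideal.isPushout_quotient_map B I
  have h' : Algebra.IsPushout (FrobeniusTwist p A) (FrobeniusTwist p (A ⧸ I))
    (FrobeniusTwist p B) (FrobeniusTwist p (B ⧸ I.map (algebraMap A B))) := h
  rw [← Algebra.IsPushout.comp_iff A (A ⧸ I) B (B ⧸ I.map (algebraMap A B))]
  exact (Algebra.IsPushout.comp_iff A (FrobeniusTwist p A) B (FrobeniusTwist p B)).mpr h'

theorem isSMulRegular_of_isPushout_frobeniusTwist {A : Type*} (B : Type*) [CommRing A]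
    [IsLocalRing A] [CommRing B] [Algebra A B] [CastEqZero p A] [CastEqZero p B]
    [Module.Flat A (FrobeniusTwist p A)]
    [h : Algebra.IsPushout A (FrobeniusTwist p A) B (FrobeniusTwist p B)] {x : A}
    (hx : x ∉ maximalIdeal A ^ 2) : IsSMulRegular B x := by
  rw [isSMulRegular_iff_right_eq_zero_of_smul]
  intro b hb
  have hinj := ((isPushout_frobeniusTwist_iff p A B).mp h).1
  have h0 : FrobeniusTwist.of p A x ⊗ₜ[A] b = 0 := by
    apply hinj
    rw [map_zero, relativeFrobenius_tmul, FrobeniusTwist.algebraMap_of, ← map_pow, ← map_mul]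
    obtain ⟨k, hk⟩ := Nat.exists_eq_succ_of_ne_zero hp.out.ne_zero
    rw [hk, pow_succ', ← mul_assoc, ← Algebra.smul_def, hb, zero_mul, map_zero]
  let J : Ideal A := LinearMap.ker (LinearMap.toSpanSingleton A B b)
  suffices J = ⊤ by
    have h1 : (1 : A) ∈ J := this ▸ Submodule.mem_top
    simpa [J] using h1
  by_contra hJ
  let f : A ⧸ J →ₗ[A] B := J.liftQ (LinearMap.toSpanSingleton A B b) le_rfl
  have hf : Function.Injective f := LinearMap.ker_eq_bot.mp (Submodule.ker_liftQ_eq_bot _ _ _ le_rfl)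
  have h1 : FrobeniusTwist.of p A x ⊗ₜ[A] (Ideal.Quotient.mk J 1) = 0 := by
    apply Module.Flat.lTensor_preserves_injective_linearMap (M := FrobeniusTwist p A) f hf
    rw [map_zero, LinearMap.lTensor_tmul, ← h0]
    congr 1
    exact one_smul A b
  have h2 := congr(tensorQuotEquivQuotSMul (FrobeniusTwist p A) J $h1)
  rw [map_zero, tensorQuotEquivQuotSMul_tmul_mk, one_smul, Submodule.Quotient.mk_eq_zero] at h2
  -- `J` acts on `F_*A` through `p`-th powers, so `J • ⊤` lies in `𝔪 ^ p ⊆ 𝔪²` because `p ≥ 2`.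
  have h3 : (J • ⊤ : Submodule A (FrobeniusTwist p A)) ≤
      ((maximalIdeal (FrobeniusTwist p A) ^ 2).restrictScalars A) := by
    rw [Submodule.smul_le]
    intro j hj n _
    rw [Algebra.smul_def, FrobeniusTwist.algebraMap_self_apply]
    exact Ideal.mul_mem_right _ _ (Ideal.pow_le_pow_right hp.out.two_le
      (Ideal.pow_mem_pow (le_maximalIdeal hJ hj) p))
  exact hx (h3 h2)

/-- The maximal ideal of a regular local ring of characteristic `p` is generated by elements which
form a weakly regular sequence on each algebra whose relative Frobenius is bijective. -/
theorem exists_isWeaklyRegular_of_isPushout_frobeniusTwist (A : Type u) [CommRing A]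
    [IsRegularLocalRing A] [CastEqZero p A] : ∃ rs : List A, Ideal.ofList rs = maximalIdeal A ∧
      ∀ (B : Type v) [CommRing B] [Algebra A B] [CastEqZero p B],
        Algebra.IsPushout A (FrobeniusTwist p A) B (FrobeniusTwist p B) → IsWeaklyRegular B rs := by
  refine IsRegularLocalRing.induction_quotient
    (P := fun A _ _ ↦ ∀ [CastEqZero p A], ∃ rs : List A, Ideal.ofList rs = maximalIdeal A ∧
      ∀ (B : Type v) [CommRing B] [Algebra A B] [CastEqZero p B],
        Algebra.IsPushout A (FrobeniusTwist p A) B (FrobeniusTwist p B) →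
          IsWeaklyRegular B rs) ?_ ?_ A
  · intro A _ _ hA _
    exact ⟨[], by rw [Ideal.ofList_nil, isField_iff_maximalIdeal_eq.mp hA], fun B _ _ _ _ ↦ .nil A B⟩
  · intro A _ _ hA ih _
    obtain ⟨x, hx, hx'⟩ := IsRegularLocalRing.exists_mem_maximalIdeal_notMem_sq hA
    have := IsRegularLocalRing.quotient_span_singleton hx hx'
    have : CastEqZero p (A ⧸ Ideal.span {x}) := .of_ringHom p (algebraMap A _)
    have := FrobeniusTwist.flat_of_isRegularLocalRing p A
    obtain ⟨rs, hrs, hreg⟩ := ih x hx hx'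
    obtain ⟨rs, rfl⟩ := (List.map_surjective_iff.mpr (Ideal.Quotient.mk_surjective)) rs
    refine ⟨x :: rs, ?_, fun B _ _ _ hB ↦ ?_⟩
    · rw [← Ideal.map_ofList, ← IsRegularLocalRing.map_mk_maximalIdeal] at hrs
      have := congr(Ideal.comap (Ideal.Quotient.mk (Ideal.span {x})) $hrs)
      rw [Ideal.comap_map_of_surjective' _ Ideal.Quotient.mk_surjective,
        Ideal.comap_map_of_surjective' _ Ideal.Quotient.mk_surjective, Ideal.mk_ker,
        sup_eq_left.mpr ((Ideal.span_singleton_le_iff_mem _).mpr hx)] at this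
      rw [Ideal.ofList_cons, sup_comm, this]
    · have : CastEqZero p (B ⧸ (Ideal.span {x}).map (algebraMap A B)) :=
        .of_ringHom p (algebraMap B _)
      refine .cons (isSMulRegular_of_isPushout_frobeniusTwist p B hx') ?_
      have h1 := hreg _ (isPushout_frobeniusTwist_quotient p A B (Ideal.span {x}))
      have h2 := (isWeaklyRegular_map_algebraMap_iff (A ⧸ Ideal.span {x}) _ rs).mp h1
      have h3 : (x • ⊤ : Submodule A B) =
          ((Ideal.span {x}).map (algebraMap A B)).restrictScalars A := by
        rw [← Ideal.smul_top_eq_map, Submodule.ideal_span_singleton_smul]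
      let e : QuotSMulTop x B ≃ₗ[A] B ⧸ (Ideal.span {x}).map (algebraMap A B) :=
        (Submodule.quotEquivOfEq _ _ h3).trans (Submodule.Quotient.restrictScalarsEquiv A _)
      exact (e.isWeaklyRegular_congr rs).mpr h2

end

/-! ### Exactness of resolutions modulo a weakly regular sequence -/

section WeaklyRegular

open RingTheory.Sequence

variable {R : Type*} [CommRing R]

/-- Regularity of `r` on `M₃` keeps the short exact sequence exact modulo `r`, which allows
induction along `rs`. -/
theorem RingTheory.Sequence.IsWeaklyRegular.of_shortExact {rs : List R}
    {M₁ M₂ M₃ : Type*} [AddCommGroup M₁] [AddCommGroup M₂] [AddCommGroup M₃] [Module R M₁]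
    [Module R M₂] [Module R M₃] (h₂ : IsWeaklyRegular M₂ rs) (h₃ : IsWeaklyRegular M₃ rs)
    {f : M₁ →ₗ[R] M₂} {g : M₂ →ₗ[R] M₃} (hf : Function.Injective f) (hfg : Function.Exact f g)
    (hg : Function.Surjective g) : IsWeaklyRegular M₁ rs := by
  induction h₂ generalizing M₁ M₃ with
  | nil => exact .nil R M₁
  | cons r rs h₂ _ ih =>
    rw [isWeaklyRegular_cons_iff] at h₃
    refine .cons (h₂.of_injective f hf) (ih h₃.2 ?_ (QuotSMulTop.map_exact r hfg hg)
      (QuotSMulTop.map_surjective r hg))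
    have h0 : Function.Exact (0 : M₁ →ₗ[R] M₁) f := fun x ↦
      ⟨fun hx ↦ ⟨0, by rw [LinearMap.zero_apply, hf (hx.trans (map_zero f).symm)]⟩, by
        rintro ⟨y, rfl⟩; simp⟩
    have h1 := QuotSMulTop.map_first_exact_on_four_term_exact_of_isSMulRegular_last h0 hfg h₃.1
    rw [map_zero] at h1
    rw [injective_iff_map_eq_zero]
    intro x hx
    obtain ⟨y, rfl⟩ := (h1 x).mp hx
    rfl

theorem Function.Exact.rTensor_quotient_ofList {rs : List R} {I : Ideal R}
    (hI : Ideal.ofList rs = I)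
    {M₁ M₂ M₃ M₄ : Type*} [AddCommGroup M₁] [AddCommGroup M₂] [AddCommGroup M₃] [AddCommGroup M₄]
    [Module R M₁] [Module R M₂] [Module R M₃] [Module R M₄] {f₁ : M₁ →ₗ[R] M₂}
    {f₂ : M₂ →ₗ[R] M₃} {f₃ : M₃ →ₗ[R] M₄} (h₁₂ : Function.Exact f₁ f₂) (h₂₃ : Function.Exact f₂ f₃)
    (h₃ : Function.Surjective f₃) (h₄ : IsWeaklyRegular M₄ rs) :
    Function.Exact (f₁.rTensor (R ⧸ I)) (f₂.rTensor (R ⧸ I)) := by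
  subst hI
  have h := map_first_exact_on_four_term_right_exact_of_isSMulRegular_last h₁₂ h₂₃ h₃ h₄
  have h1 : f₁.rTensor (R ⧸ Ideal.ofList rs) ∘ₗ (tensorQuotEquivQuotSMul M₁ (Ideal.ofList rs)).symm.toLinearMap =
      (tensorQuotEquivQuotSMul M₂ (Ideal.ofList rs)).symm.toLinearMap ∘ₗ
        Submodule.mapQ _ _ _ (Submodule.smul_top_le_comap_smul_top (Ideal.ofList rs) f₁) :=
    Submodule.linearMap_qext _ (LinearMap.ext fun x ↦ rfl)
  have h2 : f₂.rTensor (R ⧸ Ideal.ofList rs) ∘ₗ (tensorQuotEquivQuotSMul M₂ (Ideal.ofList rs)).symm.toLinearMap =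
      (tensorQuotEquivQuotSMul M₃ (Ideal.ofList rs)).symm.toLinearMap ∘ₗ
        Submodule.mapQ _ _ _ (Submodule.smul_top_le_comap_smul_top (Ideal.ofList rs) f₂) :=
    Submodule.linearMap_qext _ (LinearMap.ext fun x ↦ rfl)
  exact (Exact.iff_of_ladder_linearEquiv
    (e₁ := (tensorQuotEquivQuotSMul M₁ (Ideal.ofList rs)).symm)
    (e₂ := (tensorQuotEquivQuotSMul M₂ (Ideal.ofList rs)).symm)
    (e₃ := (tensorQuotEquivQuotSMul M₃ (Ideal.ofList rs)).symm) h1 h2).mpr h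

theorem exact_rTensor_quotient_of_isWeaklyRegular {rs : List R} {I : Ideal R}
    (hI : Ideal.ofList rs = I) (M : ℕ → Type*) [∀ n, AddCommGroup (M n)] [∀ n, Module R (M n)]
    (hM : ∀ n, IsWeaklyRegular (M n) rs) (d : ∀ n, M (n + 1) →ₗ[R] M n)
    (hd : ∀ n, Function.Exact (d (n + 1)) (d n)) (B : Type*) [AddCommGroup B] [Module R B]
    (hB : IsWeaklyRegular B rs) (ε : M 0 →ₗ[R] B) (hε : Function.Surjective ε)
    (hdε : Function.Exact (d 0) ε) (n : ℕ) :
    Function.Exact ((d (n + 1)).rTensor (R ⧸ I)) ((d n).rTensor (R ⧸ I)) := by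
  have hexact (n : ℕ) : Function.Exact (d (n + 1)) (d n).rangeRestrict := fun x ↦ by
    rw [← hd n x, Subtype.ext_iff]
    rfl
  -- Every syzygy is the kernel of a surjection between weakly regular modules, starting from `M 0 →
  -- B`.
  have hrange (n : ℕ) : IsWeaklyRegular (LinearMap.range (d n)) rs := by
    induction n with
    | zero =>
      refine (hM 0).of_shortExact hB (Submodule.injective_subtype _) (g := ε) (fun x ↦ ?_) hε
      rw [hdε x]
      simp
    | succ n ih =>
      refine (hM (n + 1)).of_shortExact ih (Submodule.injective_subtype _)
        (g := (d n).rangeRestrict) (fun x ↦ ?_) (LinearMap.surjective_rangeRestrict _)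
      rw [hexact n x]
      simp
  cases n with
  | zero => exact .rTensor_quotient_ofList hI (hd 0) hdε hε hB
  | succ n =>
    exact .rTensor_quotient_ofList hI (hd (n + 1)) (hexact n)
      (LinearMap.surjective_rangeRestrict _) (hrange n)

end WeaklyRegular

/-! ### The derived tensor product with a quotient by a weakly regular sequence -/

section DerivedTensor

open RingTheory.Sequence

variable (A : Type u) [CommRing A] (B C : Type u) [CommRing B] [CommRing C] [Algebra A B]
  [Algebra A C]

theorem derivedTensor_exactAt_succ_iff (n : ℕ) :
    (derivedTensor A B C).ExactAt (n + 1) ↔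
      Function.Exact (((projectiveResolution (ModuleCat.of A B)).complex.d (n + 2) (n + 1)).hom.rTensor C)
        (((projectiveResolution (ModuleCat.of A B)).complex.d (n + 1) n).hom.rTensor C) := by
  rw [HomologicalComplex.exactAt_iff' _ (n + 2) (n + 1) n (by simp) (by simp),
    ShortComplex.ShortExact.moduleCat_exact_iff_function_exact]
  rfl

/-- In degree zero, right exactness of the tensor product is enough. -/
theorem quasiIso_derivedTensorToTensor
    (h : ∀ n, (derivedTensor A B C).ExactAt (n + 1)) : QuasiIso (derivedTensorToTensor A B C) := by
  let P := projectiveResolution (ModuleCat.of A B)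
  refine ⟨fun n ↦ ?_⟩
  cases n with
  | succ n =>
    rw [quasiIsoAt_iff_exactAt' _ _ (ChainComplex.exactAt_succ_single_obj _ _)]
    exact h n
  | zero =>
    have hepi : Function.Surjective (P.π.f 0).hom := (ModuleCat.epi_iff_surjective _).mp inferInstance
    have hex : Function.Exact (P.complex.d 1 0).hom (P.π.f 0).hom :=
      (ShortComplex.ShortExact.moduleCat_exact_iff_function_exact _).mp P.exact₀
    have hf : (derivedTensorToTensor A B C).f 0 =
        ModuleCat.ofHom ((P.π.f 0).hom.rTensor C) := rfl
    rw [ChainComplex.quasiIsoAt₀_iff, ShortComplex.quasiIso_iff_of_zeros' _ (by simp; rfl) rfl rfl]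
    constructor
    · rw [ShortComplex.ShortExact.moduleCat_exact_iff_function_exact]
      change Function.Exact ((P.complex.d 1 0).hom.rTensor C) ((derivedTensorToTensor A B C).f 0)
      rw [hf]
      exact rTensor_exact C hex hepi
    · change Epi ((derivedTensorToTensor A B C).f 0)
      rw [hf]
      exact (ModuleCat.epi_iff_surjective (ModuleCat.ofHom _)).mpr <| LinearMap.rTensor_surjective C hepi


theorem isDiscreteDerivedTensor_of_isWeaklyRegular {rs : List A} {I : Ideal A}
    (hI : Ideal.ofList rs = I) (hA : IsWeaklyRegular A rs) (hB : IsWeaklyRegular B rs) :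
    IsDiscreteDerivedTensor A B (A ⧸ I) := by
  let P := projectiveResolution (ModuleCat.of A B)
  have hexact (n : ℕ) : (derivedTensor A B (A ⧸ I)).ExactAt (n + 1) := by
    rw [derivedTensor_exactAt_succ_iff]
    refine exact_rTensor_quotient_of_isWeaklyRegular hI (fun n ↦ P.complex.X n) (fun n ↦ ?_)
      (fun n ↦ (P.complex.d (n + 1) n).hom) (fun n ↦ ?_) B hB (P.π.f 0).hom ?_ ?_ n
    -- Projective modules are flat, so they inherit weak regularity from `A`.
    · have : Module.Projective A (P.complex.X n) :=
        (IsProjective.iff_projective _).mpr (P.projective n)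
      have := (hA.isWeaklyRegular_lTensor (M₂ := P.complex.X n))
      exact ((TensorProduct.rid A (P.complex.X n)).isWeaklyRegular_congr rs).mp this
    · exact (ShortComplex.ShortExact.moduleCat_exact_iff_function_exact _).mp (P.exact_succ n)
    · exact (ModuleCat.epi_iff_surjective (P.π.f 0)).mp inferInstance
    · exact (ShortComplex.ShortExact.moduleCat_exact_iff_function_exact _).mp P.exact₀
  exact ⟨fun n hn ↦ by obtain ⟨n, rfl⟩ := Nat.exists_eq_succ_of_ne_zero hn; exact hexact n,
    quasiIso_derivedTensorToTensor A B _ hexact⟩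

end DerivedTensor

/-! ### The relative Frobenius of global sections -/

section Gluing

variable (p : ℕ) [hp : Fact p.Prime] {A B C D : Type*} [CommRing A] [CommRing B] [CommRing C]
  [CommRing D] [Algebra A B] [Algebra A C] [Algebra A D] [CastEqZero p A] [CastEqZero p B]
  [CastEqZero p C] [CastEqZero p D]

theorem relativeFrobenius_lTensor (g : B →ₐ[A] C) (x : FrobeniusTwist p A ⊗[A] B) :
    relativeFrobenius p A C (g.toLinearMap.lTensor (FrobeniusTwist p A) x) =
      FrobeniusTwist.of p C (g ((FrobeniusTwist.of p B).symm (relativeFrobenius p A B x))) := by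
  induction x with
  | zero => simp
  | add x y hx hy => simp only [map_add, hx, hy]
  | tmul a b =>
    rw [LinearMap.lTensor_tmul, relativeFrobenius_tmul, relativeFrobenius_tmul, map_mul, map_mul,
      map_mul, map_pow, map_pow, map_pow, RingEquiv.symm_apply_apply]
    congr 1
    obtain ⟨a, rfl⟩ := (FrobeniusTwist.of p A).surjective a
    rw [FrobeniusTwist.algebraMap_of, FrobeniusTwist.algebraMap_of, RingEquiv.symm_apply_apply,
      g.commutes]

/-- Bijectivity of the relative Frobenius descends to equalizers, if the Frobenius of the base is
flat. -/
theorem relativeFrobenius_bijective_of_equalizer [Module.Flat A (FrobeniusTwist p A)]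
    (g : B →ₐ[A] C) (s t : C →ₐ[A] D) (hg : Function.Injective g)
    (hst : ∀ c, s c = t c ↔ c ∈ Set.range g)
    (hC : Function.Bijective (relativeFrobenius p A C))
    (hD : Function.Injective (relativeFrobenius p A D)) :
    Function.Bijective (relativeFrobenius p A B) := by
  have hg' := Module.Flat.lTensor_preserves_injective_linearMap (M := FrobeniusTwist p A)
    g.toLinearMap hg
  constructor
  · rw [injective_iff_map_eq_zero]
    intro x hx
    apply hg'
    apply hC.1
    rw [relativeFrobenius_lTensor, hx]
    simp
  · intro b
    have hex : Function.Exact g.toLinearMap (s.toLinearMap - t.toLinearMap) := fun c ↦ by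
      rw [LinearMap.sub_apply, sub_eq_zero]
      exact hst c
    obtain ⟨y, hy⟩ := hC.2 (FrobeniusTwist.of p C (g ((FrobeniusTwist.of p B).symm b)))
    -- Injectivity for `D` forces the two images of `y` to agree; flatness then places `y` in `F_*A
    -- ⊗ B`.
    have h0 : (s.toLinearMap - t.toLinearMap).lTensor (FrobeniusTwist p A) y = 0 := by
      rw [LinearMap.lTensor_sub, LinearMap.sub_apply, sub_eq_zero]
      apply hD
      rw [relativeFrobenius_lTensor, relativeFrobenius_lTensor, hy, RingEquiv.symm_apply_apply,
        (hst _).mpr ⟨_, rfl⟩]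
    obtain ⟨x, rfl⟩ := (Module.Flat.lTensor_exact (FrobeniusTwist p A) hex y).mp h0
    refine ⟨x, (FrobeniusTwist.of p B).symm.injective (hg ((FrobeniusTwist.of p C).injective ?_))⟩
    rw [← relativeFrobenius_lTensor]
    exact hy

end Gluing

/-! ### Sections of a scheme étale over `Spec A` -/

section Schemes

open AlgebraicGeometry TopologicalSpace Opposite

variable {A : Type u} [CommRing A] {V : Scheme.{u}}

/-- The sections of the structure sheaf of `V` over an open subset `U`, as an algebra over `A`. -/
def SectionsOver (_f : V ⟶ Spec (CommRingCat.of A)) (U : V.Opens) : Type u := Γ(V, U)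

variable (f : V ⟶ Spec (CommRingCat.of A))

instance (U : V.Opens) : CommRing (SectionsOver f U) := inferInstanceAs (CommRing Γ(V, U))

instance (U : V.Opens) : Algebra A (SectionsOver f U) :=
  ((Scheme.ΓSpecIso (CommRingCat.of A)).inv ≫ f.appTop ≫
    V.presheaf.map (homOfLE (le_top : U ≤ ⊤)).op).hom.toAlgebra

/-- Restriction of sections. -/
def SectionsOver.restrict {U W : V.Opens} (h : W ≤ U) : SectionsOver f U →ₐ[A] SectionsOver f W where
  __ := (V.presheaf.map (homOfLE h).op).hom
  commutes' a := by
    change ((Scheme.ΓSpecIso (CommRingCat.of A)).inv ≫ f.appTop ≫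
      V.presheaf.map (homOfLE (le_top : U ≤ ⊤)).op ≫ V.presheaf.map (homOfLE h).op).hom a = _
    rw [← V.presheaf.map_comp]
    rfl

/-- Restriction of global sections. -/
def GlobalSections.restrict (U : V.Opens) : GlobalSections f →ₐ[A] SectionsOver f U where
  __ := (V.presheaf.map (homOfLE (le_top : U ≤ ⊤)).op).hom
  commutes' _ := rfl

theorem SectionsOver.etale [Etale f] {U : V.Opens} (hU : IsAffineOpen U) :
    Algebra.Etale A (SectionsOver f U) := by
  have h1 := Scheme.Hom.etale_appLE f (isAffineOpen_top _) hU (le_top : U ≤ f ⁻¹ᵁ ⊤)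
  have h2 : (Scheme.ΓSpecIso (CommRingCat.of A)).inv.hom.Etale :=
    .of_bijective (ConcreteCategory.bijective_of_isIso (Scheme.ΓSpecIso (CommRingCat.of A)).inv)
  exact RingHom.Etale.stableUnderComposition _ _ h2 h1

/-- By the sheaf axiom, the global sections are the equalizer of two maps between finite products of
étale algebras, taken over affine opens and their overlaps. -/
theorem relativeFrobenius_globalSections_bijective (p : ℕ) [Fact p.Prime] [CastEqZero p A]
    [Module.Flat A (FrobeniusTwist p A)] [IsNoetherianRing A] [QuasiCompact f] [Etale f]
    [CastEqZero p (GlobalSections f)] :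
    Function.Bijective (relativeFrobenius p A (GlobalSections f)) := by
  have : IsLocallyNoetherian (Spec (CommRingCat.of A)) := isLocallyNoetherian_Spec.mpr ‹_›
  have : IsLocallyNoetherian V := LocallyOfFiniteType.isLocallyNoetherian f
  have : CompactSpace V := (quasiCompact_iff_compactSpace f).mp ‹_›
  have : IsNoetherian V := {}
  have hcover (U : V.Opens) : ∃ s : Set V.affineOpens, s.Finite ∧ U = ⨆ i ∈ s, (i : V.Opens) :=
    isCompact_iff_finite_and_eq_biUnion_affineOpens.mp (NoetherianSpace.isCompact _)
  choose c hcf hc using hcover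
  let I := c ⊤
  have : Finite I := (hcf ⊤).to_subtype
  have (U : V.Opens) : Finite (c U) := (hcf U).to_subtype
  -- `V` is not assumed separated, so each overlap is itself covered by finitely many affines; it is
  -- quasi-compact because `V` is Noetherian. Finiteness makes `C` and `D` étale over `A`.
  let K := Σ ij : I × I, c (ij.1.1.1 ⊓ ij.2.1.1)
  have hle (U : V.Opens) (i : c U) : i.1.1 ≤ U := by
    conv_rhs => rw [hc U]
    exact le_iSup₂_of_le i.1 i.2 le_rfl
  have hle₁ (k : K) : k.2.1.1 ≤ k.1.1.1.1 := (hle _ k.2).trans inf_le_left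
  have hle₂ (k : K) : k.2.1.1 ≤ k.1.2.1.1 := (hle _ k.2).trans inf_le_right
  let C := Π i : I, SectionsOver f i.1.1
  let D := Π k : K, SectionsOver f k.2.1.1
  have (i : I) : Algebra.Etale A (SectionsOver f i.1.1) := SectionsOver.etale f i.1.2
  have (k : K) : Algebra.Etale A (SectionsOver f k.2.1.1) := SectionsOver.etale f k.2.1.2
  have : CastEqZero p C := .of_ringHom p (algebraMap A C)
  have : CastEqZero p D := .of_ringHom p (algebraMap A D)
  let g : GlobalSections f →ₐ[A] C := AlgHom.pi fun i ↦ GlobalSections.restrict f i.1.1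
  let s : C →ₐ[A] D := AlgHom.pi fun k ↦
    (SectionsOver.restrict f (hle₁ k)).comp (Pi.evalAlgHom A _ k.1.1)
  let t : C →ₐ[A] D := AlgHom.pi fun k ↦
    (SectionsOver.restrict f (hle₂ k)).comp (Pi.evalAlgHom A _ k.1.2)
  have htop : (⊤ : V.Opens) ≤ ⨆ i : I, i.1.1 := (hc ⊤).le.trans (iSup_subtype').le
  have hres {U U' W : V.Opens} (h : W ≤ U') (h' : U' ≤ U) (a : Γ(V, U)) :
      (V.presheaf.map (homOfLE h).op).hom ((V.presheaf.map (homOfLE h').op).hom a) =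
        (V.presheaf.map (homOfLE (h.trans h')).op).hom a := by
    rw [← CommRingCat.comp_apply, ← V.presheaf.map_comp]
    rfl
  refine relativeFrobenius_bijective_of_equalizer p g s t ?_ (fun x ↦ ⟨fun hx ↦ ?_, ?_⟩)
    (relativeFrobenius_bijective_of_etale p A C) (relativeFrobenius_bijective_of_etale p A D).1
  · intro a b hab
    exact V.sheaf.eq_of_locally_eq' (fun i : I ↦ i.1.1) ⊤ (fun i ↦ homOfLE le_top) htop a b
      fun i ↦ congr_fun hab i
  · obtain ⟨a, ha, -⟩ := V.sheaf.existsUnique_gluing' (fun i : I ↦ i.1.1) ⊤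
      (fun i ↦ homOfLE le_top) htop x fun i j ↦ by
        refine V.sheaf.eq_of_locally_eq' (fun k : c (i.1.1 ⊓ j.1.1) ↦ k.1.1) _
          (fun k ↦ homOfLE (hle _ k)) ((hc _).le.trans (iSup_subtype').le) _ _ fun k ↦ ?_
        exact (hres _ _ _).trans ((congr_fun hx ⟨(i, j), k⟩).trans (hres _ _ _).symm)
    exact ⟨a, funext ha⟩
  · rintro ⟨a, rfl⟩
    funext k
    exact (hres _ _ _).trans (hres _ _ _).symm

end Schemes

end

theorem mainTheorem4 (A : Type u) [CommRing A] [IsRegularLocalRing A] (hA : IsExcellentRing A)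
    (p : ℕ) (hp : 0 < p) (F : Type v) [Field F] [CharP F p] (i : F →+* A)
    (V : AlgebraicGeometry.Scheme.{u}) (f : V ⟶ AlgebraicGeometry.Spec (CommRingCat.of A))
    [AlgebraicGeometry.QuasiCompact f] [AlgebraicGeometry.Etale f] :
    IsDiscreteDerivedTensor A (GlobalSections f) (IsLocalRing.ResidueField A) := by
  -- The characteristic of a field is prime or zero, and `0 < p` excludes zero.
  have : Fact p.Prime := ⟨(CharP.char_is_prime_or_zero F p).resolve_right hp.ne'⟩
  have : CastEqZero p F := ⟨CharP.cast_eq_zero F p⟩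
  have : CastEqZero p A := .of_ringHom p i
  have : CastEqZero p (GlobalSections f) := .of_ringHom p (algebraMap A _)
  have := FrobeniusTwist.flat_of_isRegularLocalRing p A
  obtain ⟨rs, hrs, hreg⟩ := exists_isWeaklyRegular_of_isPushout_frobeniusTwist.{u, u} p A
  -- The sequence `rs` does not depend on the algebra, so it serves both `A`, étale over itself, and
  -- the global sections.
  exact isDiscreteDerivedTensor_of_isWeaklyRegular A (GlobalSections f) hrs
    (hreg A ((isPushout_frobeniusTwist_iff p A A).mpr (relativeFrobenius_bijective_of_etale p A A)))
    (hreg _ ((isPushout_frobeniusTwist_iff p A _).mpr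
      (relativeFrobenius_globalSections_bijective f p)))
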